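/- Let $(M,d,0)$ be a pointed metric space which is doubling (there is $D\in\mathbb N$ such that every ball of radius $r>0$ in $M$ can be covered by at most $D$ balls of radius $r/2$) and self-similar (there are a constant $R>1$ and a bijection $f\colon M\to M$ such that $d(f(x),f(y))=R\,d(x,y)$ for all $x,y\in M$ and $f(0)=0$). Let $N\subset M$ be a net in $M$, i.e., for some $a,b>0$ the set $N$ is $a$-separated ($d(x,y)\ge a$ for all distinct $x,y\in N$) and $b$-dense in $M$ (for every $x\in M$ there is $y\in N$ with $d(x,y)\le b$), with any point of $N$ chosen as its base point. For a pointed metric space $X$ let $\mathrm{Lip}_0(X)$ denote the Banach space of all real-valued Lipschitz functions on $X$ that vanish at the base point, normed by the Lipschitz constant $$\|g\|=\sup_{x\ne y}\frac{|g(x)-g(y)|}{d(x,y)}$$ (read as $0$ if $X$ is a single point). Then $\mathrm{Lip}_0(N)\simeq \mathrm{Lip}_0(M)$, i.e., there is a bounded linear bijection $\mathrm{Lip}_0(N)\to\mathrm{Lip}_0(M)$ with bounded inverse. -/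

import Mathlib

open scoped NNReal

/-- A metric space is doubling: for some natural number `D`, every (closed) ball of radius `r > 0` is
covered by at most `D` (closed) balls of radius `r / 2`. -/
def IsDoublingSpace (M : Type*) [MetricSpace M] : Prop :=
  ∃ D : ℕ, ∀ (x : M) (r : ℝ), 0 < r →
    ∃ t : Finset M, t.card ≤ D ∧ Metric.closedBall x r ⊆ ⋃ y ∈ t, Metric.closedBall y (r / 2)

/-- A metric space pointed at `o` is self-similar: for some `R > 1` there is a bijection multiplying
all distances by `R` and fixing the base point. -/
def IsSelfSimilarAt {M : Type*} [MetricSpace M] (o : M) : Prop :=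
  ∃ R : ℝ, 1 < R ∧ ∃ f : M → M,
    Function.Bijective f ∧ (∀ x y, dist (f x) (f y) = R * dist x y) ∧ f o = o

/-- A net: a subset that is `a`-separated and `b`-dense for some positive `a`, `b`. -/
def IsMetricNet {M : Type*} [MetricSpace M] (N : Set M) : Prop :=
  ∃ a b : ℝ, 0 < a ∧ 0 < b ∧ (∀ x ∈ N, ∀ y ∈ N, x ≠ y → a ≤ dist x y) ∧
    ∀ x : M, ∃ y ∈ N, dist x y ≤ b

noncomputable section

/-- The linear space of the real-valued Lipschitz functions vanishing at `o`. -/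
def lipZeroSubmodule (M : Type*) [MetricSpace M] (o : M) : Submodule ℝ (M → ℝ) where
  carrier := {f | f o = 0 ∧ ∃ K : ℝ≥0, LipschitzWith K f}
  zero_mem' := ⟨rfl, 0, LipschitzWith.const 0⟩
  add_mem' := by
    rintro f g ⟨hf, K, hK⟩ ⟨hg, L, hL⟩
    exact ⟨by simp [hf, hg], K + L, hK.add hL⟩
  smul_mem' := by
    rintro c f ⟨hf, K, hK⟩
    refine ⟨by simp [hf], ‖c‖₊ * K, LipschitzWith.of_dist_le_mul fun x y => ?_⟩
    have h := mul_le_mul_of_nonneg_left (hK.dist_le_mul x y) (norm_nonneg c)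
    simpa [Real.dist_eq, ← mul_sub, abs_mul, mul_assoc] using h

/-- `Lip₀(M)` for the metric space `M` with base point `o`. It is a type of its own, so that it
carries the Lipschitz norm and not the topology of pointwise convergence. -/
def LipZero (M : Type*) [MetricSpace M] (o : M) : Type _ := lipZeroSubmodule M o

namespace LipZero

variable {M : Type*} [MetricSpace M] {o : M}

instance : AddCommGroup (LipZero M o) := inferInstanceAs (AddCommGroup (lipZeroSubmodule M o))

instance : Module ℝ (LipZero M o) := inferInstanceAs (Module ℝ (lipZeroSubmodule M o))

instance : CoeFun (LipZero M o) (fun _ => M → ℝ) := ⟨fun f => f.1⟩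

/-- The Lipschitz norm `sup |f x - f y| / d(x, y)` (the pairs `x = y` contribute `0 / 0 = 0`). -/
instance : Norm (LipZero M o) := ⟨fun f => ⨆ p : M × M, |f p.1 - f p.2| / dist p.1 p.2⟩

theorem norm_def (f : LipZero M o) : ‖f‖ = ⨆ p : M × M, |f p.1 - f p.2| / dist p.1 p.2 := rfl

theorem bddAbove (f : LipZero M o) :
    BddAbove (Set.range fun p : M × M => |f p.1 - f p.2| / dist p.1 p.2) := by
  obtain ⟨K, hK⟩ := f.2.2
  refine ⟨K, ?_⟩
  rintro _ ⟨p, rfl⟩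
  exact div_le_of_le_mul₀ dist_nonneg K.2 (hK.dist_le_mul p.1 p.2)

theorem abs_sub_le (f : LipZero M o) (x y : M) : |f x - f y| ≤ ‖f‖ * dist x y := by
  rcases eq_or_ne x y with rfl | h
  · simp
  · exact (div_le_iff₀ (dist_pos.2 h)).1 (le_ciSup f.bddAbove (x, y))

theorem norm_le_of_forall (f : LipZero M o) {C : ℝ} (hC : 0 ≤ C)
    (h : ∀ x y, |f x - f y| ≤ C * dist x y) : ‖f‖ ≤ C := by
  have : Nonempty (M × M) := ⟨(o, o)⟩
  exact ciSup_le fun p => div_le_of_le_mul₀ dist_nonneg hC (h p.1 p.2)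

theorem norm_nonneg' (f : LipZero M o) : 0 ≤ ‖f‖ :=
  Real.iSup_nonneg fun _ => div_nonneg (abs_nonneg _) dist_nonneg

theorem norm_smul_le' (c : ℝ) (f : LipZero M o) : ‖c • f‖ ≤ |c| * ‖f‖ := by
  refine norm_le_of_forall _ (mul_nonneg (abs_nonneg c) f.norm_nonneg') fun x y => ?_
  have h := mul_le_mul_of_nonneg_left (f.abs_sub_le x y) (abs_nonneg c)
  change |c * f x - c * f y| ≤ _
  rwa [← mul_sub, abs_mul, mul_assoc]

instance : NormedAddCommGroup (LipZero M o) :=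
  AddGroupNorm.toNormedAddCommGroup
    { toFun := fun f => ‖f‖
      map_zero' := le_antisymm
        (norm_le_of_forall _ le_rfl fun x y => by
          change |(0 : ℝ) - 0| ≤ _
          simp) (norm_nonneg' _)
      add_le' := fun f g => by
        refine norm_le_of_forall _ (add_nonneg f.norm_nonneg' g.norm_nonneg') fun x y => ?_
        change |f x + g x - (f y + g y)| ≤ _
        rw [add_sub_add_comm, add_mul]
        exact (abs_add_le _ _).trans (add_le_add (f.abs_sub_le x y) (g.abs_sub_le x y))
      neg' := fun f => by
        refine le_antisymm ?_ ?_
        · simpa using norm_smul_le' (-1) f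
        · simpa using norm_smul_le' (-1) (-f)
      eq_zero_of_map_eq_zero' := fun f hf => by
        refine Subtype.ext (funext fun x => ?_)
        have h := f.abs_sub_le x o
        have hf' : ‖f‖ = 0 := hf
        rw [hf', zero_mul, f.2.1, sub_zero] at h
        exact abs_nonpos_iff.1 h }

instance : NormedSpace ℝ (LipZero M o) where
  norm_smul_le := norm_smul_le'

end LipZero

end

open Filter Topology
open scoped BoundedContinuousFunction

/-! Put Z = ℓ∞(Lip₀(M)). Both Lip₀(N) and Lip₀(M) turn out to be isomorphic to Z, by Pełczyński's
decomposition method (`pelczynski_decomposition`), once Lip₀(N) is complemented in Lip₀(M) and Z is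
complemented in Lip₀(N).

The first complementation uses doubling. Averaging over boundedly many nearby net points extends
functions from N to M linearly with control of the Lipschitz constant, and restriction undoes this
(`LipZero.factorsThrough_of_net`).

The second uses self-similarity (`LipZero.boundedSeq_factorsThrough_net`). Given a bounded sequence
(y_i), place a copy of y_i dilated by R^((n+1)²) in the n-th of a family of disjoint annuli around
the base point, for every n = `Nat.pair i k`, and restrict the result to N. The cutoffs cost only a
constant factor because their slope at radius r is O(1/r) while the functions are O(r). The annuli
widen logarithmically, so blowing down along n = `Nat.pair i k` and letting k → ∞ recovers y_i at
every point. Rounding to the net costs a bounded distance, which the rescaling kills. An ultralimit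
makes this recovery a linear operator on all of Lip₀(N). -/

/-- `A` is isomorphic to a complemented subspace of `B`. -/
def FactorsThrough (A B : Type*) [NormedAddCommGroup A] [NormedSpace ℝ A]
    [NormedAddCommGroup B] [NormedSpace ℝ B] : Prop :=
  ∃ (T : A →L[ℝ] B) (S : B →L[ℝ] A), ∀ a, S (T a) = a

/-- A bounded family as a bounded continuous function on the discrete index space. -/
noncomputable def boundedSeq {A ι : Type*} [NormedAddCommGroup A]
    [TopologicalSpace ι] [DiscreteTopology ι] (u : ι → A) (K : ℝ)
    (h : ∀ n, ‖u n‖ ≤ K) : ι →ᵇ A :=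
  BoundedContinuousFunction.ofNormedAddCommGroupDiscrete u K h

@[simp] theorem boundedSeq_apply {A ι : Type*} [NormedAddCommGroup A]
    [TopologicalSpace ι] [DiscreteTopology ι] (u : ι → A) (K : ℝ) (h : ∀ n, ‖u n‖ ≤ K) (n : ι) :
    boundedSeq u K h n = u n := rfl

/-! ### Bounded sequence spaces and Pełczyński decomposition -/

section Decomposition

variable {A B C W : Type*} [NormedAddCommGroup A] [NormedSpace ℝ A]
  [NormedAddCommGroup B] [NormedSpace ℝ B] [NormedAddCommGroup C] [NormedSpace ℝ C]
  [NormedAddCommGroup W] [NormedSpace ℝ W]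

theorem FactorsThrough.trans (h : FactorsThrough A B) (h' : FactorsThrough B C) :
    FactorsThrough A C := by
  obtain ⟨T, S, hTS⟩ := h
  obtain ⟨T', S', hTS'⟩ := h'
  exact ⟨T'.comp T, S.comp S', fun a => by simp [hTS, hTS']⟩

theorem FactorsThrough.exists_equiv_prod (h : FactorsThrough A B) :
    ∃ W : Submodule ℝ B, Nonempty (B ≃L[ℝ] A × W) := by
  obtain ⟨T, S, hTS⟩ := h
  exact ⟨_, ⟨ContinuousLinearEquiv.equivOfRightInverse S T hTS⟩⟩

/-- A linear map into bounded sequences given by a uniformly bounded family of linear maps. -/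
theorem exists_clm_boundedSeq {ι : Type*} [TopologicalSpace ι] [DiscreteTopology ι]
    (φ : ι → A →ₗ[ℝ] B) (K : ℝ) (hK : 0 ≤ K) (h : ∀ n a, ‖φ n a‖ ≤ K * ‖a‖) :
    ∃ T : A →L[ℝ] (ι →ᵇ B), ∀ a n, T a n = φ n a := by
  let T : A →ₗ[ℝ] (ι →ᵇ B) :=
    { toFun := fun a => boundedSeq (fun n => φ n a) (K * ‖a‖) fun n => h n a
      map_add' := fun a b => by ext n; simp
      map_smul' := fun c a => by ext n; simp }
  refine ⟨T.mkContinuous K fun a => ?_, fun a n => rfl⟩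
  exact (BoundedContinuousFunction.norm_le (by positivity)).2 fun n => h n a

theorem exists_clm_eval {ι : Type*} [TopologicalSpace ι] (n : ι) :
    ∃ S : (ι →ᵇ A) →L[ℝ] A, ∀ u, S u = u n :=
  ⟨BoundedContinuousFunction.evalCLM ℝ n, fun _ => rfl⟩

/-- A continuous linear equivalence from a pair of mutually inverse continuous linear maps. -/
theorem nonempty_equiv_of_inverse (T : A →L[ℝ] B) (S : B →L[ℝ] A) (h : ∀ a, S (T a) = a)
    (h' : ∀ b, T (S b) = b) : Nonempty (A ≃L[ℝ] B) :=
  ⟨ContinuousLinearEquiv.equivOfInverse T S h h'⟩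

theorem factorsThrough_boundedSeq : FactorsThrough A (ℕ →ᵇ A) := by
  obtain ⟨T, hT⟩ := exists_clm_boundedSeq (ι := ℕ) (fun _ => (LinearMap.id : A →ₗ[ℝ] A)) 1
    zero_le_one (fun n a => by simp)
  obtain ⟨S, hS⟩ := exists_clm_eval (A := A) (0 : ℕ)
  exact ⟨T, S, fun a => by rw [hS, hT]; rfl⟩

theorem boundedSeq_congr (e : A ≃L[ℝ] B) : Nonempty ((ℕ →ᵇ A) ≃L[ℝ] (ℕ →ᵇ B)) := by
  refine nonempty_equiv_of_inverse
    ((e : A →L[ℝ] B).compLeftContinuousBounded ℕ) ((e.symm : B →L[ℝ] A).compLeftContinuousBounded ℕ)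
    (fun a => ?_) (fun b => ?_)
  · ext n; simp
  · ext n; simp

theorem boundedSeq_prod : Nonempty ((ℕ →ᵇ (A × W)) ≃L[ℝ] (ℕ →ᵇ A) × (ℕ →ᵇ W)) := by
  obtain ⟨S, hS⟩ := exists_clm_boundedSeq (ι := ℕ) (A := (ℕ →ᵇ A) × (ℕ →ᵇ W)) (B := A × W)
    (fun n => ((BoundedContinuousFunction.evalCLM ℝ n).prodMap
      (BoundedContinuousFunction.evalCLM ℝ n) : (ℕ →ᵇ A) × (ℕ →ᵇ W) →L[ℝ] A × W).toLinearMap)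
    1 zero_le_one (fun n a => by
      rw [one_mul]
      exact max_le_max (a.1.norm_coe_le_norm n) (a.2.norm_coe_le_norm n))
  refine nonempty_equiv_of_inverse
    (((ContinuousLinearMap.fst ℝ A W).compLeftContinuousBounded ℕ).prod
      ((ContinuousLinearMap.snd ℝ A W).compLeftContinuousBounded ℕ)) S (fun a => ?_) (fun b => ?_)
  · ext n <;> simp [hS]
  · refine Prod.ext ?_ ?_ <;> · ext n; simp [hS]

theorem boundedSeq_cons : Nonempty ((ℕ →ᵇ A) ≃L[ℝ] A × (ℕ →ᵇ A)) := by
  obtain ⟨T, hT⟩ := exists_clm_boundedSeq (ι := ℕ) (A := ℕ →ᵇ A) (B := A)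
    (fun n => (BoundedContinuousFunction.evalCLM ℝ (n + 1) : (ℕ →ᵇ A) →L[ℝ] A).toLinearMap)
    1 zero_le_one (fun n a => by
      rw [one_mul]
      exact a.norm_coe_le_norm (n + 1))
  let ψ : ℕ → (A × (ℕ →ᵇ A)) →L[ℝ] A := fun n => Nat.casesOn n (ContinuousLinearMap.fst ℝ _ _)
    fun k => (BoundedContinuousFunction.evalCLM ℝ k).comp (ContinuousLinearMap.snd ℝ _ _)
  obtain ⟨S, hS⟩ := exists_clm_boundedSeq (ι := ℕ) (fun n => (ψ n).toLinearMap)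
    1 zero_le_one (fun n a => by
      rw [one_mul]
      cases n with
      | zero => exact norm_fst_le a
      | succ k => exact (a.2.norm_coe_le_norm k).trans (norm_snd_le a))
  refine nonempty_equiv_of_inverse ((BoundedContinuousFunction.evalCLM ℝ 0).prod T) S
    (fun a => ?_) (fun b => ?_)
  · ext n
    rw [hS]
    cases n with
    | zero => rfl
    | succ k => exact hT a k
  · refine Prod.ext ?_ ?_
    · exact hS b 0
    · ext n
      exact (hT _ n).trans (hS b (n + 1))

/-- Reindexing along the bijection `Nat.pair` of ℕ × ℕ with ℕ. -/
theorem boundedSeq_boundedSeq : Nonempty ((ℕ →ᵇ (ℕ →ᵇ A)) ≃L[ℝ] (ℕ →ᵇ A)) := by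
  obtain ⟨T, hT⟩ := exists_clm_boundedSeq (ι := ℕ) (A := ℕ →ᵇ (ℕ →ᵇ A)) (B := A)
    (fun n => ((BoundedContinuousFunction.evalCLM ℝ n.unpair.2).comp
      (BoundedContinuousFunction.evalCLM ℝ n.unpair.1) :
        (ℕ →ᵇ (ℕ →ᵇ A)) →L[ℝ] A).toLinearMap) 1 zero_le_one (fun n a => by
      rw [one_mul]
      exact ((a n.unpair.1).norm_coe_le_norm _).trans (a.norm_coe_le_norm _))
  have h1 : ∀ i : ℕ, ∃ S : (ℕ →ᵇ A) →L[ℝ] (ℕ →ᵇ A), ∀ a k, S a k = a (Nat.pair i k) := fun i =>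
    exists_clm_boundedSeq (ι := ℕ) (A := ℕ →ᵇ A) (B := A)
      (fun k => (BoundedContinuousFunction.evalCLM ℝ (Nat.pair i k) :
        (ℕ →ᵇ A) →L[ℝ] A).toLinearMap) 1 zero_le_one (fun k a => by
      rw [one_mul]
      exact a.norm_coe_le_norm _)
  choose U hU using h1
  obtain ⟨S, hS⟩ := exists_clm_boundedSeq (ι := ℕ) (fun i => (U i).toLinearMap)
    1 zero_le_one (fun n a => by
      rw [one_mul]
      refine (BoundedContinuousFunction.norm_le (norm_nonneg a)).2 fun k => ?_
      exact (congrArg norm (hU n a k)).trans_le (a.norm_coe_le_norm _))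
  refine nonempty_equiv_of_inverse T S (fun a => ?_) (fun b => ?_)
  · ext i k
    have h := hT a (Nat.pair i k)
    rw [hS]
    refine (hU i (T a) k).trans (h.trans ?_)
    simp
  · ext n
    refine (hT _ n).trans ?_
    change S b n.unpair.1 n.unpair.2 = b n
    rw [hS]
    refine (hU _ _ _).trans ?_
    rw [Nat.pair_unpair]

/-- Pełczyński's decomposition method for a space of bounded sequences. -/
theorem pelczynski_decomposition (h : FactorsThrough A (ℕ →ᵇ C))
    (h' : FactorsThrough (ℕ →ᵇ C) A) : Nonempty (A ≃L[ℝ] (ℕ →ᵇ C)) := by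
  obtain ⟨W, ⟨eW⟩⟩ := h.exists_equiv_prod
  obtain ⟨V, ⟨eV⟩⟩ := h'.exists_equiv_prod
  obtain ⟨e₁⟩ := boundedSeq_boundedSeq (A := C)
  obtain ⟨e₂⟩ := boundedSeq_congr eW
  obtain ⟨e₃⟩ := boundedSeq_prod (A := A) (W := W)
  obtain ⟨e₄⟩ := boundedSeq_cons (A := A)
  obtain ⟨e₅⟩ := boundedSeq_cons (A := ℕ →ᵇ C)
  have e₆ : (ℕ →ᵇ C) ≃L[ℝ] (ℕ →ᵇ A) × (ℕ →ᵇ W) := e₁.symm.trans (e₂.trans e₃)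
  -- With Z = ℓ∞(C): Z ≅ ℓ∞(A) × ℓ∞(W), and ℓ∞(A) absorbs one more copy of A.
  have absorb : (ℕ →ᵇ C) ≃L[ℝ] A × (ℕ →ᵇ C) :=
    e₆.trans <| (e₄.prodCongr (ContinuousLinearEquiv.refl ℝ _)).trans <|
      (ContinuousLinearEquiv.prodAssoc ℝ _ _ _).trans <|
        (ContinuousLinearEquiv.refl ℝ A).prodCongr e₆.symm
  have square : (ℕ →ᵇ C) ≃L[ℝ] (ℕ →ᵇ C) × (ℕ →ᵇ C) :=
    e₁.symm.trans <| e₅.trans <| (ContinuousLinearEquiv.refl ℝ _).prodCongr e₁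
  -- A ≅ Z × V ≅ Z × (Z × V) ≅ Z × A ≅ A × Z ≅ Z.
  exact ⟨eV.trans <| (square.prodCongr (ContinuousLinearEquiv.refl ℝ _)).trans <|
    (ContinuousLinearEquiv.prodAssoc ℝ _ _ _).trans <|
      ((ContinuousLinearEquiv.refl ℝ _).prodCongr eV.symm).trans <|
        (ContinuousLinearEquiv.prodComm ℝ _ _).trans absorb.symm⟩

end Decomposition

/-! ### Operators into Lip₀ -/

/-- A linear family of functions with controlled Lipschitz constants, normalised at the base point,
is a bounded operator into `LipZero`. -/
theorem LipZero.exists_clm {E M : Type*} [NormedAddCommGroup E] [NormedSpace ℝ E] [MetricSpace M]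
    (o : M) (Φ : E →ₗ[ℝ] (M → ℝ)) (C : ℝ) (hC : 0 ≤ C)
    (h : ∀ e x y, |Φ e x - Φ e y| ≤ C * ‖e‖ * dist x y) :
    ∃ T : E →L[ℝ] LipZero M o, ∀ e x, T e x = Φ e x - Φ e o := by
  let T : E →ₗ[ℝ] LipZero M o :=
    { toFun := fun e => ⟨fun x => Φ e x - Φ e o, by simp, (C * ‖e‖).toNNReal,
        LipschitzWith.of_dist_le_mul fun x y => by
          rw [Real.dist_eq, Real.coe_toNNReal _ (by positivity), sub_sub_sub_cancel_right]
          exact h e x y⟩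
      map_add' := fun a b => Subtype.ext <| funext fun x => by
        change Φ (a + b) x - Φ (a + b) o = (Φ a x - Φ a o) + (Φ b x - Φ b o)
        rw [map_add, Pi.add_apply, Pi.add_apply, add_sub_add_comm]
      map_smul' := fun c a => Subtype.ext <| funext fun x => by
        change Φ (c • a) x - Φ (c • a) o = c * (Φ a x - Φ a o)
        rw [map_smul, Pi.smul_apply, Pi.smul_apply, smul_eq_mul, smul_eq_mul, mul_sub] }
  refine ⟨T.mkContinuous C fun e => ?_, fun e x => rfl⟩
  refine LipZero.norm_le_of_forall _ (by positivity) fun x y => ?_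
  change |Φ e x - Φ e o - (Φ e y - Φ e o)| ≤ _
  rw [sub_sub_sub_cancel_right]
  exact h e x y

theorem LipZero.apply_base {M : Type*} [MetricSpace M] {o : M} (f : LipZero M o) : f o = 0 := f.2.1

theorem LipZero.add_apply {M : Type*} [MetricSpace M] {o : M} (f g : LipZero M o) (x : M) :
    (f + g) x = f x + g x := rfl

theorem LipZero.smul_apply {M : Type*} [MetricSpace M] {o : M} (c : ℝ) (f : LipZero M o) (x : M) :
    (c • f) x = c * f x := rfl

theorem LipZero.ext_apply {M : Type*} [MetricSpace M] {o : M} {f g : LipZero M o}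
    (h : ∀ x, f x = g x) : f = g := Subtype.ext (funext h)

/-! ### Counting net points in balls -/

section Doubling

variable {M : Type*} [MetricSpace M]

theorem exists_cover_div_two_pow {D : ℕ} (hD : ∀ (x : M) (r : ℝ), 0 < r →
    ∃ t : Finset M, t.card ≤ D ∧ Metric.closedBall x r ⊆ ⋃ y ∈ t, Metric.closedBall y (r / 2))
    (k : ℕ) (x : M) (r : ℝ) (hr : 0 < r) : ∃ t : Finset M, t.card ≤ D ^ k ∧
      Metric.closedBall x r ⊆ ⋃ y ∈ t, Metric.closedBall y (r / 2 ^ k) := by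
  classical
  induction k with
  | zero => exact ⟨{x}, by simp⟩
  | succ k ih =>
    obtain ⟨t, ht, hcov⟩ := ih
    choose u hu hu' using fun y => hD y (r / 2 ^ k) (by positivity)
    refine ⟨t.biUnion u, ?_, fun z hz => ?_⟩
    · rw [pow_succ]
      exact (Finset.card_biUnion_le_card_mul _ _ _ fun y _ => hu y).trans
        (Nat.mul_le_mul_right _ ht)
    · obtain ⟨y, hy, hzy⟩ := Set.mem_iUnion₂.1 (hcov hz)
      obtain ⟨w, hw, hzw⟩ := Set.mem_iUnion₂.1 (hu' y hzy)
      refine Set.mem_iUnion₂.2 ⟨w, Finset.mem_biUnion.2 ⟨y, hy, hw⟩, ?_⟩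
      rwa [pow_succ, ← div_div]

/-- In a doubling space the balls of a given radius contain boundedly many points of a separated
set. -/
theorem IsDoublingSpace.exists_card_le (hM : IsDoublingSpace M) {N : Set M} {a : ℝ} (ha : 0 < a)
    (hN : ∀ x ∈ N, ∀ y ∈ N, x ≠ y → a ≤ dist x y) (r : ℝ) (hr : 0 < r) :
    ∃ C : ℕ, ∀ x : M, ∃ s : Finset N, s.card ≤ C ∧ ∀ p : N, p ∈ s ↔ dist x p ≤ r := by
  classical
  obtain ⟨D, hD⟩ := hM
  -- Balls of radius r / 2 ^ k have diameter below a, so each contains at most one point of N and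
  -- the covering number bounds the count.
  obtain ⟨k, hk⟩ := pow_unbounded_of_one_lt (2 * r / a) one_lt_two
  have hk' : 2 * (r / 2 ^ k) < a := by
    rw [div_lt_iff₀ ha] at hk
    rw [← mul_div_assoc, div_lt_iff₀ (by positivity)]
    linarith
  refine ⟨D ^ k, fun x => ?_⟩
  obtain ⟨t, ht, hcov⟩ := exists_cover_div_two_pow hD k x r hr
  have h1 : ∀ p : {p : N | dist x p ≤ r}, ∃ y : t, dist (p : M) y ≤ r / 2 ^ k := fun p => by
    obtain ⟨y, hy, hpy⟩ := Set.mem_iUnion₂.1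
      (hcov (show (p : M) ∈ Metric.closedBall x r by
        rw [Metric.mem_closedBall, dist_comm]; exact p.2))
    exact ⟨⟨y, hy⟩, hpy⟩
  choose c hc using h1
  have hinj : Function.Injective c := fun p q hpq => by
    by_contra hne
    have h2 : (p : M) ≠ q := fun h => hne (Subtype.ext (Subtype.ext h))
    have h3 := hN p p.1.2 q q.1.2 h2
    have h4 := hc p
    have h5 := hc q
    rw [← hpq] at h5
    have h6 := dist_triangle_right (p : M) q (c p)
    linarith
  have : Finite {p : N | dist x p ≤ r} := Finite.of_injective c hinj
  have hfin : {p : N | dist x p ≤ r}.Finite := this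
  refine ⟨hfin.toFinset, ?_, fun p => by simp⟩
  rw [← Nat.card_eq_card_finite_toFinset hfin]
  refine (Nat.card_le_card_of_injective c hinj).trans ?_
  simpa using ht

end Doubling

/-! ### Linear extension from a net -/

section Extension

variable {M : Type*} [MetricSpace M]

/-- The weight at `x` of a net point `p`; at a point of the `a`-separated set `N` all but its own
weight vanish. -/
noncomputable def netWeight (N : Set M) (a : ℝ) (p : N) (x : M) : ℝ :=
  max 0 (2 * Metric.infDist x N + a / 2 - dist x p)

/-- The average of `g` with respect to the net weights. -/
noncomputable def netExtend (N : Set M) (a : ℝ) (g : N → ℝ) (x : M) : ℝ :=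
  (∑ᶠ p, netWeight N a p x * g p) / ∑ᶠ p, netWeight N a p x

theorem netWeight_nonneg (N : Set M) (a : ℝ) (p : N) (x : M) : 0 ≤ netWeight N a p x :=
  le_max_left _ _

theorem abs_netWeight_sub_le (N : Set M) (a : ℝ) (p : N) (x y : M) :
    |netWeight N a p x - netWeight N a p y| ≤ 3 * dist x y := by
  rw [netWeight, netWeight, max_comm 0, max_comm 0]
  refine (abs_max_sub_max_le_abs _ _ _).trans ?_
  have h1 := Metric.infDist_le_infDist_add_dist (s := N) (x := x) (y := y)
  have h2 := Metric.infDist_le_infDist_add_dist (s := N) (x := y) (y := x)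
  have h3 := dist_triangle x y p
  have h4 := dist_triangle y x p
  rw [dist_comm y x] at h2 h4
  rw [abs_le]
  constructor <;> linarith

theorem dist_le_of_netWeight_ne_zero {N : Set M} {a b : ℝ} (hb : ∀ x : M, ∃ y ∈ N, dist x y ≤ b)
    {p : N} {x : M} (h : netWeight N a p x ≠ 0) : dist x p ≤ 2 * b + a / 2 := by
  obtain ⟨y, hy, hxy⟩ := hb x
  have h1 := (Metric.infDist_le_dist_of_mem (x := x) hy).trans hxy
  by_contra hlt
  exact h (max_eq_left (by linarith))

theorem netExtend_eq_sum {N : Set M} {a b : ℝ} (hb : ∀ x : M, ∃ y ∈ N, dist x y ≤ b)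
    {x : M} {t : Finset N} (ht : ∀ p : N, dist x p ≤ 2 * b + a / 2 → p ∈ t) (g : N → ℝ) :
    netExtend N a g x = (∑ p ∈ t, netWeight N a p x * g p) / ∑ p ∈ t, netWeight N a p x := by
  rw [netExtend, finsum_eq_sum_of_support_subset, finsum_eq_sum_of_support_subset]
  · exact fun p hp => ht p (dist_le_of_netWeight_ne_zero hb hp)
  · exact fun p hp => ht p (dist_le_of_netWeight_ne_zero hb (left_ne_zero_of_mul hp))

/-- A net point within `infDist` + a / 4 of x already has weight at least a / 4. This keeps the
denominators of the averages away from zero uniformly. -/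
theorem le_sum_netWeight {N : Set M} {a b : ℝ} (ha : 0 < a)
    (hb : ∀ x : M, ∃ y ∈ N, dist x y ≤ b) {x : M} {t : Finset N}
    (ht : ∀ p : N, dist x p ≤ 2 * b + a / 2 → p ∈ t) :
    a / 4 ≤ ∑ p ∈ t, netWeight N a p x := by
  obtain ⟨y, hy, -⟩ := hb x
  obtain ⟨p, hp, hxp⟩ := (Metric.infDist_lt_iff ⟨y, hy⟩).1
    (show Metric.infDist x N < Metric.infDist x N + a / 4 by linarith)
  have h0 := Metric.infDist_nonneg (x := x) (s := N)
  have h1 : a / 4 ≤ netWeight N a ⟨p, hp⟩ x := le_max_of_le_right (by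
    change a / 4 ≤ 2 * Metric.infDist x N + a / 2 - dist x p
    linarith)
  refine h1.trans (Finset.single_le_sum (f := fun p => netWeight N a p x)
    (fun q _ => netWeight_nonneg N a q x) (ht _ (dist_le_of_netWeight_ne_zero hb ?_)))
  intro h
  linarith

theorem netExtend_apply_coe {N : Set M} {a : ℝ} (ha : 0 < a)
    (hsep : ∀ x ∈ N, ∀ y ∈ N, x ≠ y → a ≤ dist x y) (g : N → ℝ) (q : N) :
    netExtend N a g q = g q := by
  have h0 : Metric.infDist (q : M) N = 0 := Metric.infDist_zero_of_mem q.2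
  have h1 : netWeight N a q q = a / 2 := by
    rw [netWeight, h0, dist_self, max_eq_right] <;> linarith
  have h2 : ∀ p, p ≠ q → netWeight N a p q = 0 := fun p hp => by
    have := hsep q q.2 p p.2 fun h => hp (Subtype.ext h.symm)
    rw [netWeight, h0, max_eq_left]
    linarith
  rw [netExtend, finsum_eq_single _ q h2, finsum_eq_single _ q fun p hp => by rw [h2 p hp, zero_mul],
    h1, mul_div_cancel_left₀ _ (by positivity)]

theorem abs_weighted_average_sub_le {ι : Type*} (t : Finset ι) (w h : ι → ℝ) (c H : ℝ)
    (hw : ∀ p ∈ t, 0 ≤ w p) (hW : 0 < ∑ p ∈ t, w p) (hH : ∀ p ∈ t, w p ≠ 0 → |h p - c| ≤ H) :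
    |(∑ p ∈ t, w p * h p) / (∑ p ∈ t, w p) - c| ≤ H := by
  have h1 : (∑ p ∈ t, w p * h p) / (∑ p ∈ t, w p) - c
      = (∑ p ∈ t, w p * (h p - c)) / ∑ p ∈ t, w p := by
    simp only [mul_sub, Finset.sum_sub_distrib, ← Finset.sum_mul]
    field_simp
  rw [h1, abs_div, abs_of_pos hW, div_le_iff₀ hW, Finset.mul_sum]
  refine (Finset.abs_sum_le_sum_abs _ _).trans (Finset.sum_le_sum fun p hp => ?_)
  rw [abs_mul, abs_of_nonneg (hw p hp), mul_comm H]
  rcases eq_or_ne (w p) 0 with h0 | h0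
  · simp [h0]
  · exact mul_le_mul_of_nonneg_left (hH p hp h0) (hw p hp)

/-- Averages commute with subtracting the constant c, so only the oscillation H of h around c
enters. One factor H * ε comes from changing the weights in the numerator, the other from changing
the total weight. -/
theorem abs_weighted_average_sub_average_le {ι : Type*} (t : Finset ι) (v w h : ι → ℝ)
    (c H δ ε : ℝ) (hδ : 0 < δ) (hw : ∀ p ∈ t, 0 ≤ w p)
    (hV : δ ≤ ∑ p ∈ t, v p) (hW : δ ≤ ∑ p ∈ t, w p) (hH : ∀ p ∈ t, |h p - c| ≤ H) (hH0 : 0 ≤ H)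
    (hvw : ∑ p ∈ t, |v p - w p| ≤ ε) :
    |(∑ p ∈ t, v p * h p) / (∑ p ∈ t, v p) - (∑ p ∈ t, w p * h p) / (∑ p ∈ t, w p)|
      ≤ 2 * H * ε / δ := by
  have hV0 := hδ.trans_le hV
  have hW0 := hδ.trans_le hW
  have key := abs_weighted_average_sub_le t w h c H hw hW0 fun p hp _ => hH p hp
  set Q := (∑ p ∈ t, w p * h p) / (∑ p ∈ t, w p) - c with hQ
  have e1 : (∑ p ∈ t, v p * h p) / (∑ p ∈ t, v p) - (∑ p ∈ t, w p * h p) / (∑ p ∈ t, w p)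
      = (∑ p ∈ t, (v p - w p) * (h p - c) - Q * ∑ p ∈ t, (v p - w p)) / ∑ p ∈ t, v p := by
    simp only [hQ, mul_sub, sub_mul, Finset.sum_sub_distrib, ← Finset.sum_mul]
    field_simp
    ring
  have b1 : |∑ p ∈ t, (v p - w p) * (h p - c)| ≤ H * ε := by
    refine (Finset.abs_sum_le_sum_abs _ _).trans ?_
    calc ∑ p ∈ t, |(v p - w p) * (h p - c)| ≤ ∑ p ∈ t, H * |v p - w p| :=
          Finset.sum_le_sum fun p hp => by
            rw [abs_mul, mul_comm]
            exact mul_le_mul_of_nonneg_right (hH p hp) (abs_nonneg _)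
      _ ≤ H * ε := by
          rw [← Finset.mul_sum]
          exact mul_le_mul_of_nonneg_left hvw hH0
  have b2 : |Q * ∑ p ∈ t, (v p - w p)| ≤ H * ε := by
    rw [abs_mul]
    exact mul_le_mul key ((Finset.abs_sum_le_sum_abs _ _).trans hvw) (abs_nonneg _) hH0
  have hε : 0 ≤ ε := (Finset.sum_nonneg fun _ _ => abs_nonneg _).trans hvw
  rw [e1, abs_div, abs_of_pos hV0]
  refine div_le_div₀ (by positivity) ?_ hδ hV
  refine (abs_sub _ _).trans ?_
  linarith

/-- The Lipschitz functions on a net of a doubling space extend linearly and boundedly. -/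
theorem exists_abs_netExtend_sub_le (hM : IsDoublingSpace M) {N : Set M} {a b : ℝ} (ha : 0 < a)
    (hb : 0 < b) (hsep : ∀ x ∈ N, ∀ y ∈ N, x ≠ y → a ≤ dist x y)
    (hden : ∀ x : M, ∃ y ∈ N, dist x y ≤ b) :
    ∃ C : ℝ, 0 ≤ C ∧ ∀ (K : ℝ) (g : N → ℝ), 0 ≤ K → (∀ p q, |g p - g q| ≤ K * dist p q) →
      ∀ x y, |netExtend N a g x - netExtend N a g y| ≤ C * K * dist x y := by
  classical
  set ρ := 2 * b + a / 2 with hρ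
  obtain ⟨D, hD⟩ := hM.exists_card_le ha hsep ρ (by positivity)
  choose s hs hmem using hD
  choose ν hνN hν using hden
  have hden : ∀ x : M, ∃ y ∈ N, dist x y ≤ b := fun x => ⟨ν x, hνN x, hν x⟩
  -- C₁ serves pairs at distance at most b, where the two averages run over a common set of at most
  -- 2 * D net points. C₂ serves pairs at distance at least b, where each average is replaced by the
  -- value at a nearby net point and the additive error is absorbed into dist x y.
  let C₁ : ℝ := 2 * (ρ + 2 * b) * (2 * D * 3) / (a / 4)
  let C₂ : ℝ := (2 * (ρ + b) + 2 * b) / b + 1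
  have hC₁ : 0 ≤ C₁ := by positivity
  have hC₂ : 0 ≤ C₂ := by positivity
  refine ⟨C₁ + C₂, by positivity, fun K g hK hg x y => ?_⟩
  have hgd : ∀ z : M, ∀ p : N, |g p - g ⟨ν z, hνN z⟩| ≤ K * (dist z p + b) := fun z p => by
    refine (hg _ _).trans (mul_le_mul_of_nonneg_left ?_ hK)
    change dist (p : M) (ν z) ≤ _
    have := dist_triangle_left (p : M) (ν z) z
    have := hν z
    linarith
  have bound : |netExtend N a g x - netExtend N a g y| ≤ max C₁ C₂ * K * dist x y := by
    rcases le_total (dist x y) b with hxy | hxy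
    · refine le_trans ?_ (mul_le_mul_of_nonneg_right
        (mul_le_mul_of_nonneg_right (le_max_left _ _) hK) dist_nonneg)
      have hx : ∀ p : N, dist x p ≤ ρ → p ∈ s x ∪ s y := fun p hp =>
        Finset.mem_union_left _ ((hmem x p).2 hp)
      have hy : ∀ p : N, dist y p ≤ ρ → p ∈ s x ∪ s y := fun p hp =>
        Finset.mem_union_right _ ((hmem y p).2 hp)
      rw [netExtend_eq_sum hden hx, netExtend_eq_sum hden hy]
      refine (abs_weighted_average_sub_average_le (s x ∪ s y) _ _ g (g ⟨ν x, hνN x⟩)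
        (K * (ρ + 2 * b)) (a / 4) (2 * D * (3 * dist x y)) (by positivity)
        (fun p _ => netWeight_nonneg N a p y) (le_sum_netWeight ha hden hx)
        (le_sum_netWeight ha hden hy) (fun p hp => ?_) (by positivity) ?_).trans_eq ?_
      · refine (hgd x p).trans (mul_le_mul_of_nonneg_left ?_ hK)
        rcases Finset.mem_union.1 hp with h | h
        · have := (hmem x p).1 h
          linarith
        · have := (hmem y p).1 h
          have := dist_triangle x y p
          linarith
      · refine (Finset.sum_le_card_nsmul _ _ _ fun p _ =>
          abs_netWeight_sub_le N a p x y).trans ?_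
        rw [nsmul_eq_mul]
        refine mul_le_mul_of_nonneg_right ?_ (by positivity)
        have h1 := (Finset.card_union_le (s x) (s y)).trans (add_le_add (hs x) (hs y))
        have h2 : ((s x ∪ s y).card : ℝ) ≤ (D : ℝ) + D := by exact_mod_cast h1
        linarith
      · simp only [C₁]
        ring
    · refine le_trans ?_ (mul_le_mul_of_nonneg_right
        (mul_le_mul_of_nonneg_right (le_max_right _ _) hK) dist_nonneg)
      have near : ∀ z, |netExtend N a g z - g ⟨ν z, hνN z⟩| ≤ K * (ρ + b) := fun z => by
        have hz : ∀ p : N, dist z p ≤ ρ → p ∈ s z := fun p hp => (hmem z p).2 hp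
        rw [netExtend_eq_sum hden hz]
        refine abs_weighted_average_sub_le _ _ _ _ _ (fun p _ => netWeight_nonneg N a p z)
          ((by positivity : 0 < a / 4).trans_le (le_sum_netWeight ha hden hz)) fun p hp _ => ?_
        refine (hgd z p).trans (mul_le_mul_of_nonneg_left ?_ hK)
        have := (hmem z p).1 hp
        linarith
      have h1 := abs_le.1 (near x)
      have h2 := abs_le.1 (near y)
      have h3 := abs_le.1 ((hg ⟨ν x, hνN x⟩ ⟨ν y, hνN y⟩).trans (mul_le_mul_of_nonneg_left
        (show dist (⟨ν x, hνN x⟩ : N) ⟨ν y, hνN y⟩ ≤ dist x y + 2 * b by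
          change dist (ν x) (ν y) ≤ _
          have := dist_triangle4 (ν x) x y (ν y)
          have := hν x
          have := hν y
          rw [dist_comm] at this
          have := dist_comm (ν x) x
          have := dist_comm (ν y) y
          linarith) hK))
      have h4 : 2 * (ρ + b) + 2 * b ≤ (2 * (ρ + b) + 2 * b) / b * dist x y := by
        rw [div_mul_eq_mul_div, le_div_iff₀ hb]
        exact mul_le_mul_of_nonneg_left hxy (by positivity)
      have h5 := mul_le_mul_of_nonneg_left h4 hK
      have h6 : C₂ * K * dist x y
          = K * ((2 * (ρ + b) + 2 * b) / b * dist x y) + K * dist x y := by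
        simp only [C₂]
        ring
      rw [h6, abs_le]
      constructor <;> linarith [h1.1, h1.2, h2.1, h2.2, h3.1, h3.2]
  refine bound.trans (mul_le_mul_of_nonneg_right (mul_le_mul_of_nonneg_right ?_ hK) dist_nonneg)
  exact max_le (by linarith) (by linarith)

theorem LipZero.factorsThrough_of_net (hM : IsDoublingSpace M) (o : M) {N : Set M}
    (hN : IsMetricNet N) (p : N) : FactorsThrough (LipZero N p) (LipZero M o) := by
  obtain ⟨a, b, ha, hb, hsep, hden⟩ := hN
  obtain ⟨C, hC, hE⟩ := exists_abs_netExtend_sub_le hM ha hb hsep hden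
  obtain ⟨D, hD⟩ := hM.exists_card_le ha hsep (2 * b + a / 2) (by positivity)
  choose s hs hmem using hD
  have hsum := fun x (g : N → ℝ) => netExtend_eq_sum hden (fun q hq => (hmem x q).2 hq) g
  obtain ⟨T, hT⟩ := LipZero.exists_clm (E := LipZero N p) o
    { toFun := fun g x => netExtend N a g x
      map_add' := fun g h => funext fun x => by
        simp only [Pi.add_apply, hsum, LipZero.add_apply, mul_add, Finset.sum_add_distrib, add_div]
      map_smul' := fun c g => funext fun x => by
        simp only [Pi.smul_apply, hsum, LipZero.smul_apply, smul_eq_mul, RingHom.id_apply,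
          mul_left_comm _ c, ← Finset.mul_sum, mul_div_assoc] }
    C hC fun g x y => hE ‖g‖ g (norm_nonneg g) g.abs_sub_le x y
  obtain ⟨S, hS⟩ := LipZero.exists_clm (E := LipZero M o) p
    { toFun := fun g x => g x
      map_add' := fun g h => rfl
      map_smul' := fun c g => rfl }
    1 zero_le_one fun g x y => by
      rw [one_mul]
      exact g.abs_sub_le x y
  -- Extension renormalises at o and restriction at p; the two constants cancel because g p = 0.
  refine ⟨T, S, fun g => LipZero.ext_apply fun x => ?_⟩
  rw [hS]
  change T g x - T g p = g x
  rw [hT, hT]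
  change netExtend N a g x - netExtend N a g o - (netExtend N a g p - netExtend N a g o) = g x
  rw [netExtend_apply_coe ha hsep, netExtend_apply_coe ha hsep, g.apply_base]
  ring

end Extension

/-! ### Limits along an ultrafilter -/

section Ultralimit

/-- The limit of a sequence of reals along a fixed nonprincipal ultrafilter. -/
noncomputable def ultralimit (u : ℕ → ℝ) : ℝ := limUnder (hyperfilter ℕ : Filter ℕ) u

theorem tendsto_ultralimit {u : ℕ → ℝ} {K : ℝ} (h : ∀ n, |u n| ≤ K) :
    Tendsto u (hyperfilter ℕ : Filter ℕ) (𝓝 (ultralimit u)) := by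
  have hmem : ((hyperfilter ℕ).map u : Filter ℝ) ≤ 𝓟 (Set.Icc (-K) K) := by
    rw [le_principal_iff]
    exact Filter.mem_map.2 (Filter.Eventually.of_forall fun n => abs_le.1 (h n))
  obtain ⟨x, -, hx⟩ := isCompact_Icc.ultrafilter_le_nhds ((hyperfilter ℕ).map u) hmem
  exact tendsto_nhds_limUnder ⟨x, hx⟩

theorem ultralimit_eq_of_tendsto {u : ℕ → ℝ} {l : ℝ} (h : Tendsto u atTop (𝓝 l)) :
    ultralimit u = l :=
  (h.mono_left Nat.hyperfilter_le_atTop).limUnder_eq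

end Ultralimit

/-! ### Radial cutoffs on disjoint annuli -/

section Cutoff

/-- The cutoff function with value `0` up to `α`, value `1` from `R * α` on, and affine between. -/
noncomputable def radialStep (R α r : ℝ) : ℝ := max 0 (min 1 ((r / α - 1) / (R - 1)))

variable {R α r r' : ℝ}

theorem radialStep_eq_zero (hR : 1 < R) (hα : 0 < α) (h : r ≤ α) : radialStep R α r = 0 := by
  have h1 : r / α ≤ 1 := (div_le_one hα).2 h
  exact max_eq_left ((min_le_right _ _).trans
    (div_nonpos_of_nonpos_of_nonneg (by linarith) (by linarith)))

theorem radialStep_eq_one (hR : 1 < R) (hα : 0 < α) (h : R * α ≤ r) : radialStep R α r = 1 := by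
  have h1 : R ≤ r / α := (le_div_iff₀ hα).2 h
  have h2 : 1 ≤ (r / α - 1) / (R - 1) := (le_div_iff₀ (by linarith)).2 (by linarith)
  rw [radialStep, min_eq_left h2, max_eq_right zero_le_one]

theorem radialStep_mem : 0 ≤ radialStep R α r ∧ radialStep R α r ≤ 1 :=
  ⟨le_max_left _ _, max_le zero_le_one (min_le_left _ _)⟩

/-- The slope is at most 1 / (α (R - 1)), and the step is constant beyond R * α, so the smaller
radius r may be taken at most R * α. The bound is therefore independent of the scale α. -/
theorem mul_abs_radialStep_sub_le_of_le (hR : 1 < R) (hα : 0 < α) (h : r ≤ r') :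
    r * |radialStep R α r - radialStep R α r'| ≤ R / (R - 1) * |r - r'| := by
  have hR' : 0 < R - 1 := by linarith
  rcases le_total (R * α) r with h1 | h1
  · rw [radialStep_eq_one hR hα h1, radialStep_eq_one hR hα (h1.trans h), sub_self, abs_zero,
      mul_zero]
    positivity
  · have h2 : |radialStep R α r - radialStep R α r'| ≤ |r - r'| / (α * (R - 1)) := by
      rw [radialStep, radialStep, max_comm 0, max_comm 0]
      refine (abs_max_sub_max_le_abs _ _ _).trans ?_
      rw [min_comm 1, min_comm 1]
      refine (abs_min_sub_min_le_max _ _ _ _).trans (max_le (le_of_eq ?_) ?_)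
      · rw [← sub_div, sub_sub_sub_cancel_right, ← sub_div, abs_div, abs_div, abs_of_pos hα,
          abs_of_pos hR', div_div]
      · rw [sub_self, abs_zero]
        positivity
    refine (mul_le_mul h1 h2 (abs_nonneg _) (by positivity)).trans_eq ?_
    field_simp

/-- The bump function that is `1` on `[R ^ (n² + n + 1), R ^ (n² + 3n + 1)]` and vanishes outside
`[R ^ (n² + n), R ^ (n² + 3n + 2)]`. -/
noncomputable def annulusBump (R : ℝ) (n : ℕ) (r : ℝ) : ℝ :=
  radialStep R (R ^ (n ^ 2 + n)) r - radialStep R (R ^ (n ^ 2 + 3 * n + 1)) r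

theorem annulusBump_eq_one (hR : 1 < R) {n : ℕ} (h : R ^ (n ^ 2 + n + 1) ≤ r)
    (h' : r ≤ R ^ (n ^ 2 + 3 * n + 1)) : annulusBump R n r = 1 := by
  rw [annulusBump, radialStep_eq_one hR (by positivity) (by rwa [← pow_succ']),
    radialStep_eq_zero hR (by positivity) h', sub_zero]

theorem lt_of_annulusBump_ne_zero (hR : 1 < R) {n : ℕ} (h : annulusBump R n r ≠ 0) :
    R ^ (n ^ 2 + n) < r ∧ r < R ^ (n ^ 2 + 3 * n + 2) := by
  constructor
  · by_contra! hle
    have hle' : r ≤ R ^ (n ^ 2 + 3 * n + 1) :=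
      hle.trans (pow_le_pow_right₀ hR.le (by omega))
    exact h (by rw [annulusBump, radialStep_eq_zero hR (by positivity) hle,
      radialStep_eq_zero hR (by positivity) hle', sub_self])
  · by_contra! hle
    have hle' : R ^ (n ^ 2 + n + 1) ≤ r :=
      (pow_le_pow_right₀ hR.le (by omega)).trans hle
    exact h (by rw [annulusBump, radialStep_eq_one hR (by positivity) (by rwa [← pow_succ']),
      radialStep_eq_one hR (by positivity) (by rwa [← pow_succ']), sub_self])

theorem abs_annulusBump_le_one (n : ℕ) : |annulusBump R n r| ≤ 1 := by
  have h1 := radialStep_mem (R := R) (α := R ^ (n ^ 2 + n)) (r := r)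
  have h2 := radialStep_mem (R := R) (α := R ^ (n ^ 2 + 3 * n + 1)) (r := r)
  rw [annulusBump, abs_le]
  constructor <;> linarith [h1.1, h1.2, h2.1, h2.2]

theorem mul_abs_annulusBump_sub_le_of_le (hR : 1 < R) (n : ℕ) (hr : 0 ≤ r) (h : r ≤ r') :
    r * |annulusBump R n r - annulusBump R n r'| ≤ 2 * (R / (R - 1)) * |r - r'| := by
  have h1 := mul_abs_radialStep_sub_le_of_le hR (α := R ^ (n ^ 2 + n)) (by positivity) h
  have h2 := mul_abs_radialStep_sub_le_of_le hR (α := R ^ (n ^ 2 + 3 * n + 1)) (by positivity) h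
  have h3 : |annulusBump R n r - annulusBump R n r'|
      ≤ |radialStep R (R ^ (n ^ 2 + n)) r - radialStep R (R ^ (n ^ 2 + n)) r'|
        + |radialStep R (R ^ (n ^ 2 + 3 * n + 1)) r
          - radialStep R (R ^ (n ^ 2 + 3 * n + 1)) r'| := by
    rw [annulusBump, annulusBump, sub_sub_sub_comm]
    exact abs_sub _ _
  have h4 := mul_le_mul_of_nonneg_left h3 hr
  linarith

/-- The exponents of the n-th support run from (n + 1)² - (n + 1) to (n + 1)² + (n + 1), which is
where the next support begins. -/
theorem annulusBump_eq_zero_of_ne (hR : 1 < R) {n l : ℕ} (hnl : n ≠ l)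
    (h : annulusBump R n r ≠ 0) : annulusBump R l r = 0 := by
  by_contra h'
  obtain ⟨h1, h2⟩ := lt_of_annulusBump_ne_zero hR h
  obtain ⟨h3, h4⟩ := lt_of_annulusBump_ne_zero hR h'
  rcases lt_or_gt_of_ne hnl with hlt | hlt
  · exact absurd (h2.trans_le (pow_le_pow_right₀ hR.le
      (show n ^ 2 + 3 * n + 2 ≤ l ^ 2 + l by nlinarith))) (not_lt.2 h3.le)
  · exact absurd (h4.trans_le (pow_le_pow_right₀ hR.le
      (show l ^ 2 + 3 * l + 2 ≤ n ^ 2 + n by nlinarith))) (not_lt.2 h1.le)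

/-- A choice of the annulus containing a given radius. -/
theorem exists_annulus_index (hR : 1 < R) :
    ∃ idx : ℝ → ℕ, ∀ n r, n ≠ idx r → annulusBump R n r = 0 := by
  classical
  -- The default 0 is harmless: it is used only at radii where every bump vanishes.
  refine ⟨fun r => if h : ∃ n, annulusBump R n r ≠ 0 then h.choose else 0, fun n r hn => ?_⟩
  by_contra h
  have hex : ∃ n, annulusBump R n r ≠ 0 := ⟨n, h⟩
  simp only [dif_pos hex] at hn
  exact hex.choose_spec (annulusBump_eq_zero_of_ne hR hn h)

end Cutoff

/-! ### Gluing Lipschitz functions along annuli -/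

section Gluing

variable {M : Type*} [MetricSpace M]

/-- A product rule: u grows at most linearly from its zero at o, which compensates the 1 / r slope
of the bump. Ordering the points lets u be evaluated at the one nearer to o. -/
theorem abs_annulusBump_mul_sub_le {R : ℝ} (hR : 1 < R) (n : ℕ) (o : M) {u : M → ℝ} {K : ℝ}
    (hu0 : u o = 0) (hK : 0 ≤ K) (hu : ∀ x y, |u x - u y| ≤ K * dist x y) (x y : M) :
    |annulusBump R n (dist x o) * u x - annulusBump R n (dist y o) * u y|
      ≤ (2 * (R / (R - 1)) + 1) * K * dist x y := by
  wlog h : dist x o ≤ dist y o generalizing x y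
  · rw [abs_sub_comm, dist_comm x y]
    exact this y x (le_of_not_ge h)
  have h1 := mul_abs_annulusBump_sub_le_of_le hR n dist_nonneg h
  have h2 : |dist x o - dist y o| ≤ dist x y := abs_dist_sub_le x y o
  have h3 : |u x| ≤ K * dist x o := by simpa [hu0] using hu x o
  have hR' : 0 < R - 1 := by linarith
  set β := annulusBump R n (dist x o)
  set γ := annulusBump R n (dist y o)
  have hγ : |γ| ≤ 1 := abs_annulusBump_le_one n
  have e1 : β * u x - γ * u y = γ * (u x - u y) + u x * (β - γ) := by ring
  rw [e1]
  refine (abs_add_le _ _).trans ?_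
  rw [abs_mul, abs_mul]
  have h4 : |γ| * |u x - u y| ≤ 1 * (K * dist x y) :=
    mul_le_mul hγ (hu x y) (abs_nonneg _) zero_le_one
  have h5 : |u x| * |β - γ| ≤ K * (2 * (R / (R - 1)) * dist x y) := by
    refine (mul_le_mul_of_nonneg_right h3 (abs_nonneg _)).trans ?_
    rw [mul_assoc]
    refine mul_le_mul_of_nonneg_left (h1.trans ?_) hK
    exact mul_le_mul_of_nonneg_left h2 (by positivity)
  linarith

/-- Lipschitz functions glued along disjoint annuli form a Lipschitz function. -/
theorem abs_glued_sub_le {R : ℝ} (hR : 1 < R) {idx : ℝ → ℕ}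
    (hidx : ∀ n r, n ≠ idx r → annulusBump R n r = 0) (o : M) {u : ℕ → M → ℝ} {K : ℝ}
    (hu0 : ∀ n, u n o = 0) (hK : 0 ≤ K) (hu : ∀ n x y, |u n x - u n y| ≤ K * dist x y) (x y : M) :
    |annulusBump R (idx (dist x o)) (dist x o) * u (idx (dist x o)) x
        - annulusBump R (idx (dist y o)) (dist y o) * u (idx (dist y o)) y|
      ≤ 2 * (2 * (R / (R - 1)) + 1) * K * dist x y := by
  have key := fun n => abs_annulusBump_mul_sub_le hR n o (hu0 n) hK (hu n) x y
  have hR' : 0 < R - 1 := by linarith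
  have hpos : 0 ≤ (2 * (R / (R - 1)) + 1) * K * dist x y := by positivity
  rcases eq_or_ne (idx (dist x o)) (idx (dist y o)) with h | h
  · rw [h]
    refine (key _).trans ?_
    linarith
  -- Each of the two bumps involved vanishes at the other point, so two applications of the
  -- single-bump estimate suffice, whatever the number of annuli in between.
  · have h1 := key (idx (dist x o))
    have h2 := key (idx (dist y o))
    rw [hidx _ _ h, zero_mul, sub_zero] at h1
    rw [hidx _ _ h.symm, zero_mul, zero_sub, abs_neg] at h2
    refine (abs_sub _ _).trans ?_
    linarith

end Gluing

/-! ### Blowing down and encoding sequences -/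

section Dilation

variable {M : Type*} [MetricSpace M]

theorem dist_iterate_of_dilation {R : ℝ} {f : M → M} (hf : ∀ x y, dist (f x) (f y) = R * dist x y)
    (m : ℕ) (x y : M) : dist (f^[m] x) (f^[m] y) = R ^ m * dist x y := by
  induction m with
  | zero => simp
  | succ m ih => rw [Function.iterate_succ_apply', Function.iterate_succ_apply', hf, ih, pow_succ',
      mul_assoc]

/-- The exponent (n + 1)² is n away from both ends of the plateau of the n-th bump. The spare factor
R ^ n absorbs both r and the rounding error b, and for fixed r > 0 the two conditions hold for all
large n. -/
theorem mem_annulus_of_abs_sub_le {R b r s : ℝ} (hR : 1 < R) (hb : 0 ≤ b) {n : ℕ}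
    (h1 : 1 + b ≤ R ^ n * r) (h2 : r + b ≤ R ^ n) (hs : |s - R ^ ((n + 1) ^ 2) * r| ≤ b) :
    R ^ (n ^ 2 + n + 1) ≤ s ∧ s ≤ R ^ (n ^ 2 + 3 * n + 1) := by
  obtain ⟨h3, h4⟩ := abs_le.1 hs
  have e1 : R ^ ((n + 1) ^ 2) = R ^ (n ^ 2 + n + 1) * R ^ n := by
    rw [← pow_add]
    congr 1
    ring
  have e2 : R ^ (n ^ 2 + 3 * n + 1) = R ^ ((n + 1) ^ 2) * R ^ n := by
    rw [← pow_add]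
    congr 1
    ring
  have g1 : 1 ≤ R ^ (n ^ 2 + n + 1) := one_le_pow₀ hR.le
  have g2 : 1 ≤ R ^ ((n + 1) ^ 2) := one_le_pow₀ hR.le
  constructor
  · have h5 := mul_le_mul_of_nonneg_left h1 (zero_le_one.trans g1)
    have h6 := mul_le_mul_of_nonneg_right g1 hb
    rw [e1, mul_assoc] at h3
    linarith
  · have h5 := mul_le_mul_of_nonneg_left h2 (zero_le_one.trans g2)
    have h6 := mul_le_mul_of_nonneg_right g2 hb
    rw [e2]
    linarith

/-- The exponent of the dilation that carries the `k`-th approximation of the `i`-th function. -/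
def dilationExponent (i k : ℕ) : ℕ := (Nat.pair i k + 1) ^ 2

theorem tendsto_pair_atTop (i : ℕ) : Tendsto (fun k => Nat.pair i k) atTop atTop :=
  tendsto_atTop_mono (fun k => Nat.right_le_pair i k) tendsto_id

theorem tendsto_inv_pow_dilationExponent {R : ℝ} (hR : 1 < R) (i : ℕ) :
    Tendsto (fun k => (R ^ dilationExponent i k)⁻¹) atTop (𝓝 0) := by
  refine tendsto_inv_atTop_zero.comp ((tendsto_pow_atTop_atTop_of_one_lt hR).comp ?_)
  refine tendsto_atTop_mono (fun k => ?_) (tendsto_pair_atTop i)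
  simp only [dilationExponent]
  nlinarith

/-- Blowing down: the limit of the rescaled values of `g` at net points near dilates of a point is
a Lipschitz function. -/
theorem exists_blowDown {R : ℝ} (hR : 1 < R) {f : M → M}
    (hf : ∀ x y, dist (f x) (f y) = R * dist x y) {o : M} (ho : f o = o) {N : Set M} {b : ℝ}
    {ν : M → N} (hν : ∀ x : M, dist x (ν x : M) ≤ b) (p : N) :
    ∃ S : LipZero N p →L[ℝ] (ℕ →ᵇ LipZero M o), ∀ g i x,
      S g i x = ultralimit fun k =>
        (R ^ dilationExponent i k)⁻¹ * g (ν (f^[dilationExponent i k] x)) := by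
  have hinv : ∀ m : ℕ, 0 < (R ^ m)⁻¹ := fun m => by positivity
  have hinv1 : ∀ m : ℕ, (R ^ m)⁻¹ ≤ 1 := fun m => inv_le_one_of_one_le₀ (one_le_pow₀ hR.le)
  have hνd : ∀ (m : ℕ) (x y : M),
      dist (ν (f^[m] x)) (ν (f^[m] y)) ≤ R ^ m * dist x y + 2 * b := fun m x y => by
    have h1 := dist_triangle4 (ν (f^[m] x) : M) (f^[m] x) (f^[m] y) (ν (f^[m] y))
    have h2 := hν (f^[m] x)
    have h3 := hν (f^[m] y)
    rw [dist_comm] at h2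
    rw [dist_iterate_of_dilation hf] at h1
    change dist (ν (f^[m] x) : M) (ν (f^[m] y)) ≤ _
    linarith
  -- Rounding to the net adds 2 * b before rescaling, hence an error that vanishes in the limit; the
  -- blow-down has Lipschitz constant at most ‖g‖.
  have hdiff : ∀ (g : LipZero N p) (m : ℕ) (x y : M),
      |(R ^ m)⁻¹ * g (ν (f^[m] x)) - (R ^ m)⁻¹ * g (ν (f^[m] y))|
        ≤ ‖g‖ * (dist x y + 2 * b * (R ^ m)⁻¹) := fun g m x y => by
    rw [← mul_sub, abs_mul, abs_of_pos (hinv m)]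
    refine (mul_le_mul_of_nonneg_left ((g.abs_sub_le _ _).trans
      (mul_le_mul_of_nonneg_left (hνd m x y) (norm_nonneg g))) (hinv m).le).trans_eq ?_
    have : R ^ m ≠ 0 := by positivity
    field_simp
  have hiter : ∀ m : ℕ, f^[m] o = o := fun m => Function.iterate_fixed ho m
  have hbd : ∀ (g : LipZero N p) (x : M) (m : ℕ), |(R ^ m)⁻¹ * g (ν (f^[m] x))|
      ≤ ‖g‖ * (dist x o + 2 * b) + |g (ν o)| := fun g x m => by
    have hb : 0 ≤ b := dist_nonneg.trans (hν o)
    have h1 := hdiff g m x o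
    rw [hiter] at h1
    have h2 : |(R ^ m)⁻¹ * g (ν o)| ≤ |g (ν o)| := by
      rw [abs_mul, abs_of_pos (hinv m)]
      exact mul_le_of_le_one_left (abs_nonneg _) (hinv1 m)
    have h3 : ‖g‖ * (dist x o + 2 * b * (R ^ m)⁻¹) ≤ ‖g‖ * (dist x o + 2 * b) := by
      refine mul_le_mul_of_nonneg_left ?_ (norm_nonneg g)
      have := mul_le_of_le_one_right (by positivity : 0 ≤ 2 * b) (hinv1 m)
      linarith
    have h4 := abs_add_le ((R ^ m)⁻¹ * g (ν (f^[m] x)) - (R ^ m)⁻¹ * g (ν o)) ((R ^ m)⁻¹ * g (ν o))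
    rw [sub_add_cancel] at h4
    linarith
  have hlim := fun (g : LipZero N p) (i : ℕ) (x : M) =>
    tendsto_ultralimit fun k => hbd g x (dilationExponent i k)
  let Φ : ℕ → LipZero N p →ₗ[ℝ] (M → ℝ) := fun i =>
    { toFun := fun g x => ultralimit fun k =>
        (R ^ dilationExponent i k)⁻¹ * g (ν (f^[dilationExponent i k] x))
      map_add' := fun g h => funext fun x => by
        refine tendsto_nhds_unique (hlim (g + h) i x) (((hlim g i x).add (hlim h i x)).congr ?_)
        exact fun k => (mul_add _ _ _).symm
      map_smul' := fun c g => funext fun x => by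
        refine tendsto_nhds_unique (hlim (c • g) i x) (((hlim g i x).const_mul c).congr ?_)
        exact fun k => mul_left_comm _ _ _ }
  have hΦ : ∀ i g x y, |Φ i g x - Φ i g y| ≤ 1 * ‖g‖ * dist x y := fun i g x y => by
    have h1 := ((hlim g i x).sub (hlim g i y)).abs
    have h2 : Tendsto (fun k => ‖g‖ * (dist x y + 2 * b * (R ^ dilationExponent i k)⁻¹))
        (hyperfilter ℕ : Filter ℕ) (𝓝 (‖g‖ * (dist x y + 2 * b * 0))) :=
      ((((tendsto_inv_pow_dilationExponent hR i).const_mul (2 * b)).const_add _).const_mul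
        _).mono_left Nat.hyperfilter_le_atTop
    rw [mul_zero, add_zero] at h2
    rw [one_mul]
    exact le_of_tendsto_of_tendsto' h1 h2 fun k => hdiff g _ x y
  -- Since f fixes o, the sequence there is R^(-m) times the constant g (ν o).
  have hΦ0 : ∀ i g, Φ i g o = 0 := fun i g => by
    refine ultralimit_eq_of_tendsto ?_
    have h := (tendsto_inv_pow_dilationExponent hR i).mul_const (g (ν o))
    rw [zero_mul] at h
    exact h.congr fun k => by rw [hiter]
  choose U hU using fun i => LipZero.exists_clm o (Φ i) 1 zero_le_one (hΦ i)
  have hU' : ∀ i g x, U i g x = Φ i g x := fun i g x => by rw [hU, hΦ0, sub_zero]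
  obtain ⟨S, hS⟩ := exists_clm_boundedSeq (ι := ℕ) (fun i => (U i).toLinearMap) 1 zero_le_one
    fun i g => LipZero.norm_le_of_forall _ (by positivity) fun x y => by
      change |U i g x - U i g y| ≤ _
      rw [hU', hU']
      exact hΦ i g x y
  refine ⟨S, fun g i x => ?_⟩
  rw [hS]
  exact hU' i g x

/-- Bounded sequences of Lipschitz functions on a self-similar space are encoded by Lipschitz
functions on a net. -/
theorem LipZero.boundedSeq_factorsThrough_net {o : M} (hS : IsSelfSimilarAt o) {N : Set M}
    (hN : IsMetricNet N) (p : N) : FactorsThrough (ℕ →ᵇ LipZero M o) (LipZero N p) := by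
  obtain ⟨R, hR, f, hbij, hf, ho⟩ := hS
  obtain ⟨a, b, ha, hb, hsep, hden⟩ := hN
  choose ν₀ hνN hν₀ using hden
  let ν : M → N := fun x => ⟨ν₀ x, hνN x⟩
  have hν : ∀ x : M, dist x (ν x : M) ≤ b := hν₀
  obtain ⟨S, hS⟩ := exists_blowDown hR hf ho hν p
  obtain ⟨h, hhf, hfh⟩ := Function.bijective_iff_has_inverse.1 hbij
  have hd : ∀ (m : ℕ) (x y : M), dist x y = R ^ m * dist (h^[m] x) (h^[m] y) := fun m x y => by
    rw [← dist_iterate_of_dilation hf, hfh.iterate m, hfh.iterate m]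
  have hho : ∀ m : ℕ, h^[m] o = o := fun m =>
    Function.iterate_fixed ((congrArg h ho).symm.trans (hhf o)) m
  obtain ⟨idx, hidx⟩ := exists_annulus_index hR
  let m : ℕ → ℕ := fun n => (n + 1) ^ 2
  -- Conjugation by the dilation, with h the inverse of f, preserves Lipschitz constants. Decoding n
  -- by `Nat.unpair` makes each y i occur in infinitely many annuli.
  let u : (ℕ →ᵇ LipZero M o) → ℕ → M → ℝ := fun y n x => R ^ m n * y n.unpair.1 (h^[m n] x)
  have hu0 : ∀ y n, u y n o = 0 := fun y n => by
    simp only [u, hho, LipZero.apply_base, mul_zero]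
  have hu : ∀ y n x x', |u y n x - u y n x'| ≤ ‖y‖ * dist x x' := fun y n x x' => by
    simp only [u]
    rw [← mul_sub, abs_mul, abs_of_pos (by positivity), hd (m n) x x', mul_left_comm]
    refine mul_le_mul_of_nonneg_left (((y n.unpair.1).abs_sub_le _ _).trans ?_) (by positivity)
    exact mul_le_mul_of_nonneg_right (y.norm_coe_le_norm _) dist_nonneg
  let G : (ℕ →ᵇ LipZero M o) → M → ℝ := fun y x =>
    annulusBump R (idx (dist x o)) (dist x o) * u y (idx (dist x o)) x
  have hR' : 0 < R - 1 := by linarith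
  obtain ⟨T, hT⟩ := LipZero.exists_clm (E := ℕ →ᵇ LipZero M o) p
    { toFun := fun y x => G y x
      map_add' := fun y z => funext fun x => by
        change _ * (_ * (y _ _ + z _ _)) = _ * (_ * y _ _) + _ * (_ * z _ _)
        ring
      map_smul' := fun c y => funext fun x => by
        change _ * (_ * (c * y _ _)) = c * (_ * (_ * y _ _))
        ring }
    (2 * (2 * (R / (R - 1)) + 1)) (by positivity)
    fun y x x' => abs_glued_sub_le hR hidx o (hu0 y) (norm_nonneg y) (hu y) x x'
  refine ⟨T, S, fun y => ?_⟩
  ext i : 1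
  refine LipZero.ext_apply fun x => ?_
  rcases eq_or_ne x o with rfl | hx
  · rw [LipZero.apply_base, LipZero.apply_base]
  rw [hS]
  refine ultralimit_eq_of_tendsto ?_
  have hx0 : 0 < dist x o := dist_pos.2 hx
  have hpow : Tendsto (fun k => R ^ Nat.pair i k) atTop atTop :=
    (tendsto_pow_atTop_atTop_of_one_lt hR).comp (tendsto_pair_atTop i)
  -- The two error terms come from rounding to the net and from normalising T y at p instead of o.
  have hzero : Tendsto (fun k => (R ^ dilationExponent i k)⁻¹ * (‖y‖ * b + |G y p|)) atTop
      (𝓝 0) := by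
    simpa using (tendsto_inv_pow_dilationExponent hR i).mul_const (‖y‖ * b + |G y p|)
  rw [tendsto_iff_dist_tendsto_zero]
  refine squeeze_zero' (Eventually.of_forall fun _ => dist_nonneg) ?_ hzero
  filter_upwards [hpow.eventually_ge_atTop ((1 + b) / dist x o),
    hpow.eventually_ge_atTop (dist x o + b)] with k hk1 hk2
  set n := Nat.pair i k with hn
  have hmn : dilationExponent i k = m n := rfl
  rw [hmn]
  set q : N := ν (f^[m n] x)
  have hq : dist (f^[m n] x) q ≤ b := hν _
  have hann := mem_annulus_of_abs_sub_le (s := dist (q : M) o) hR hb.le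
    ((div_le_iff₀ hx0).1 hk1) hk2 (by
      have h1 := dist_iterate_of_dilation hf (m n) x o
      rw [Function.iterate_fixed ho] at h1
      rw [← h1]
      refine (abs_dist_sub_le _ _ _).trans ?_
      rwa [dist_comm])
  have hone := annulusBump_eq_one hR hann.1 hann.2
  -- The bump equals 1 at q, so the chosen index must be n, and the glued function at q is the
  -- dilated copy of y i.
  have hidxn : idx (dist (q : M) o) = n := by
    by_contra hne
    rw [hidx n _ (Ne.symm hne)] at hone
    exact zero_ne_one hone
  have hGq : G y q = R ^ m n * y i (h^[m n] q) := by
    simp only [G, u, hidxn, hone, one_mul]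
    rw [hn, Nat.unpair_pair]
  have hpos : 0 < R ^ m n := by positivity
  have e1 : (R ^ m n)⁻¹ * T y q - y i x
      = (y i (h^[m n] q) - y i x) - (R ^ m n)⁻¹ * G y p := by
    have hTq : T y q = G y q - G y p := hT y q
    rw [hTq, hGq]
    field_simp
    ring
  rw [Real.dist_eq, e1]
  refine (abs_sub _ _).trans ?_
  rw [abs_mul, abs_of_pos (inv_pos.2 hpos), mul_add]
  refine add_le_add ?_ le_rfl
  refine ((y i).abs_sub_le _ _).trans ?_
  have h2 : dist (h^[m n] q) x ≤ (R ^ m n)⁻¹ * b := by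
    rw [le_inv_mul_iff₀ hpos]
    have h3 := hd (m n) q (f^[m n] x)
    rw [hhf.iterate (m n), dist_comm] at h3
    rwa [← h3]
  rw [mul_left_comm]
  exact mul_le_mul (y.norm_coe_le_norm i) h2 dist_nonneg (norm_nonneg y)

end Dilation

/-! ### Conclusion -/

theorem corollary5 {M : Type*} [MetricSpace M] (o : M) (hD : IsDoublingSpace M)
    (hS : IsSelfSimilarAt o) (N : Set M) (hN : IsMetricNet N) (p : N) :
    Nonempty (LipZero N p ≃L[ℝ] LipZero M o) := by
  have h₁ : FactorsThrough (LipZero N p) (LipZero M o) := LipZero.factorsThrough_of_net hD o hN p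
  have h₂ : FactorsThrough (ℕ →ᵇ LipZero M o) (LipZero N p) :=
    LipZero.boundedSeq_factorsThrough_net hS hN p
  -- The decomposition is applied twice with the same sequence space ℓ∞(Lip₀(M)), once for each of
  -- the two spaces.
  obtain ⟨e₁⟩ := pelczynski_decomposition (h₁.trans factorsThrough_boundedSeq) h₂
  obtain ⟨e₂⟩ := pelczynski_decomposition factorsThrough_boundedSeq (h₂.trans h₁)
  exact ⟨e₁.trans e₂.symm⟩
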